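/- Let $1\le r<\infty$ be an integer, and let $M$ and $N$ be Hausdorff $C^r$-manifolds (without boundary) of positive dimensions $m$ and $n$ respectively; $m$ and $n$ are not assumed equal, and $M$ and $N$ need not be second-countable, paracompact or connected. Let $C^r(M)$ and $C^r(N)$ denote the algebras of real-valued $C^r$-functions on $M$ and $N$. Let $\mathcal{B}\colon C^r(N)\to C^r(M)$ be a multiplicative bijection, that is, a bijective map with $\mathcal{B}(gh)=\mathcal{B}(g)\mathcal{B}(h)$ for all $g,h\in C^r(N)$. Then there exists a unique $C^r$-diffeomorphism $\phi\colon M\to N$ such that $$\mathcal{B}(g)(x)=g(\phi(x))\qquad\text{for all } g\in C^r(N),\ x\in M.$$ In particular, $\mathcal{B}$ is an isomorphism of real algebras. -/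

import Mathlib

open scoped Manifold ContDiff

/-!
A multiplicative isomorphism `e : C^r(N) ≃* C^r(M)` remembers the points of the manifolds.
If no point `y` of `M` corresponded to `x`, in the sense that `g = 1` near `x` implies `e g = 1`
near `y`, then for bumps `q k` with disjoint supports shrinking to `x` the sum of all
`e (q (2 * k))` would be locally finite on `M`, hence the image under `e` of a function on `N` with
oscillating values near `x` (`MulEquiv.exists_forall_eventuallyEq_one`). This yields a homeomorphism
`φ : M ≃ₜ N` such that `e` induces isomorphisms of germs (`MulEquiv.exists_liesOver`). In particular
`e` preserves invertibility and positivity of germs.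

On positive functions `e` becomes, in logarithmic coordinates, an additive map
`A u = log (e (exp u))`, and the claim is that `A u (y) = p y * u (φ y)` with `p = A 1`. If this
fails at points `y k` whose images `z k` accumulate at `x`, for functions `w k` on `N`, then the
germs at `z k` of `exp (n k * w k - round (n k * w k (z k)) - L k)`, with `n k = (L k) ^ 2` and `L k`
large, can be glued to a `C^r` function vanishing at `x`, as the factor `exp (-L k)` beats the
derivatives, which grow polynomially in `n k`. The values of its image at `y k` are at least `1`,
because `n k` times the defect of `w k` beats `L k`; this contradicts continuity
(`LiesOver.not_frequently_logHom_ne`). So the exceptional points are isolated, and continuity of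
both sides removes them. No continuity or linearity of `A` is needed in advance.

Hence `|e g| = |g ∘ φ| ^ p`. The exponents of `e` and `e.symm` are inverse to each other, and they
are positive as functions with an isolated zero show. If `p y < 1`, then for every `f` in `C^r(N)`
and every `y'` near `y` the function `|f ∘ φ - f (φ y')| ^ p` is the absolute value of a
differentiable function vanishing at `y'`, so `f ∘ φ` has zero derivative in a chart at `y`, and `f`
is constant near `φ y`: impossible (`LiesOver.one_le_logHom_one`). Thus `p ≥ 1` for both `e` and
`e.symm`, and `p = 1`. Together with `e (-1) = -1` this gives `e g = g ∘ φ`, and coordinate functions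
show that `φ` and its inverse are of class `C^r`.
-/

open Filter Set Topology

/-! ### Functions of class `C^r` on a Hausdorff manifold -/

section Manifold

variable {E : Type*} [NormedAddCommGroup E] [InnerProductSpace ℝ E]
  {M : Type*} [TopologicalSpace M] [ChartedSpace E M] {r : ℕ}

theorem nhdsNE_neBot_of_chartedSpace (E : Type*) [NormedAddCommGroup E] [NormedSpace ℝ E]
    [Nontrivial E] [ChartedSpace E M] (x : M) : (𝓝[≠] x).NeBot := by
  rw [neBot_iff, ne_eq, ← isOpen_singleton_iff_punctured_nhds]
  intro h
  have h1 := (chartAt E x).isOpen_image_of_subset_source h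
    (singleton_subset_iff.2 (mem_chart_source E x))
  rw [image_singleton, isOpen_singleton_iff_punctured_nhds] at h1
  exact NeBot.ne inferInstance h1

theorem isCountablyGenerated_nhds_of_chartedSpace (E : Type*) [TopologicalSpace E]
    [FirstCountableTopology E] [ChartedSpace E M] (x : M) : (𝓝 x).IsCountablyGenerated := by
  rw [(chartAt E x).nhds_eq_comap_inf_principal (mem_chart_source E x)]
  infer_instance

variable [FiniteDimensional ℝ E] [T2Space M] [IsManifold 𝓘(ℝ, E) r M]

/-- Bump functions are of class `C^r` on a manifold of class `C^r`, which need not be smooth. -/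
theorem SmoothBumpFunction.contMDiff_natCast {c : M} (f : SmoothBumpFunction 𝓘(ℝ, E) c) :
    ContMDiff 𝓘(ℝ, E) 𝓘(ℝ) r f := by
  refine contMDiff_of_tsupport fun x hx => ?_
  have hx' : x ∈ (chartAt E c).source := f.tsupport_subset_chartAt_source hx
  refine ContMDiffAt.congr_of_eventuallyEq ?_ <| f.eqOn_source.eventuallyEq_of_mem <|
    (chartAt E c).open_source.mem_nhds hx'
  exact f.contDiffAt.contMDiffAt.comp _ (contMDiffAt_extChartAt' hx')

theorem ContMDiffMap.exists_bump (x : M) {U : Set M} (hU : U ∈ 𝓝 x) :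
    ∃ f : C^r⟮𝓘(ℝ, E), M; ℝ⟯, (f =ᶠ[𝓝 x] 1) ∧ tsupport f ⊆ U := by
  obtain ⟨f, -, hf⟩ := (SmoothBumpFunction.nhds_basis_tsupport (I := 𝓘(ℝ, E)) x).mem_iff.1 hU
  exact ⟨⟨f, f.contMDiff_natCast⟩, f.eventuallyEq_one, hf⟩

/-- Every germ of a `C^r` function is the germ of a globally defined one. -/
theorem ContMDiffMap.exists_eventuallyEq {x : M} {h : M → ℝ}
    (hh : ContMDiffAt 𝓘(ℝ, E) 𝓘(ℝ) r h x) :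
    ∃ f : C^r⟮𝓘(ℝ, E), M; ℝ⟯, f =ᶠ[𝓝 x] h := by
  have h1 := (contMDiffAt_iff_contMDiffAt_nhds (by simp)).1 hh
  obtain ⟨b, hb1, hb⟩ := ContMDiffMap.exists_bump (E := E) (r := r) x h1
  refine ⟨⟨fun y => b y • h y, contMDiff_of_tsupport fun y hy => ?_⟩, ?_⟩
  · exact b.contMDiff.contMDiffAt.smul (hb (tsupport_smul_subset_left _ _ hy))
  · filter_upwards [hb1] with y hy
    simp [hy]

/-- The square of the distance to `x` in a chart is, near `x`, a function vanishing at `x` only. -/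
theorem ContMDiffMap.exists_isolated_zero (x : M) :
    ∃ f : C^r⟮𝓘(ℝ, E), M; ℝ⟯, f x = 0 ∧ ∀ᶠ z in 𝓝[≠] x, 0 < f z := by
  have h1 : ContMDiffAt 𝓘(ℝ, E) 𝓘(ℝ) r
      (fun z => ‖extChartAt 𝓘(ℝ, E) x z - extChartAt 𝓘(ℝ, E) x x‖ ^ 2) x := by
    have h2 : ContDiff ℝ r fun v : E => ‖v - extChartAt 𝓘(ℝ, E) x x‖ ^ 2 :=
      (contDiff_id.sub contDiff_const).norm_sq ℝ
    exact h2.contMDiff.contMDiffAt.comp x contMDiffAt_extChartAt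
  obtain ⟨f, hf⟩ := ContMDiffMap.exists_eventuallyEq h1
  refine ⟨f, by simpa using hf.self_of_nhds, ?_⟩
  filter_upwards [hf.filter_mono nhdsWithin_le_nhds, self_mem_nhdsWithin,
    nhdsWithin_le_nhds (extChartAt_source_mem_nhds (I := 𝓘(ℝ, E)) x)] with z hz hne hs
  rw [hz]
  have : extChartAt 𝓘(ℝ, E) x z - extChartAt 𝓘(ℝ, E) x x ≠ 0 := fun h0 =>
    hne ((extChartAt 𝓘(ℝ, E) x).injOn hs (mem_extChartAt_source x) (sub_eq_zero.1 h0))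
  positivity

end Manifold

/-! ### Sequences with disjoint neighbourhoods -/

/-- A point of accumulation of `S` is the limit of a sequence in `S` whose terms have pairwise
disjoint neighbourhoods shrinking to that point. -/
theorem exists_seq_pairwise_disjoint_nhds {X : Type*} [TopologicalSpace X] [T2Space X]
    {x : X} [(𝓝 x).IsCountablyGenerated] {S : Set X} (hx : ∃ᶠ z in 𝓝[≠] x, z ∈ S) {V : Set X}
    (hV : V ∈ 𝓝 x) :
    ∃ (z : ℕ → X) (U : ℕ → Set X), (∀ k, z k ∈ S) ∧ (∀ k, IsOpen (U k)) ∧ (∀ k, z k ∈ U k) ∧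
      (∀ k, U k ⊆ V) ∧ Pairwise (Function.onFun Disjoint U) ∧
      ∀ W ∈ 𝓝 x, ∀ᶠ k in atTop, U k ⊆ W := by
  obtain ⟨b, hb⟩ := (𝓝 x).exists_antitone_basis
  have step : ∀ W : {W : Set X // W ∈ 𝓝 x}, ∃ (z : X) (U : Set X) (W' : {W : Set X // W ∈ 𝓝 x}),
      z ∈ S ∧ IsOpen U ∧ z ∈ U ∧ U ⊆ W ∧ (W' : Set X) ⊆ W ∧ Disjoint U (W' : Set X) := by
    rintro ⟨W, hW⟩
    have hW' : ∀ᶠ z in 𝓝[≠] x, z ∈ interior W :=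
      mem_nhdsWithin_of_mem_nhds (interior_mem_nhds.2 hW)
    have hne : ∀ᶠ z in 𝓝[≠] x, z ≠ x := self_mem_nhdsWithin
    obtain ⟨z, hzS, hzW, hzx⟩ := (hx.and_eventually (hW'.and hne)).exists
    obtain ⟨U, U', hU, hU', hzU, hxU', hd⟩ := t2_separation hzx
    exact ⟨z, U ∩ interior W, ⟨U' ∩ W, inter_mem (hU'.mem_nhds hxU') hW⟩, hzS,
      hU.inter isOpen_interior, ⟨hzU, hzW⟩, inter_subset_right.trans interior_subset,
      inter_subset_right, hd.mono inter_subset_left inter_subset_left⟩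
  choose z U next hzS hUo hzU hUW hnext hdisj using step
  let inter' (k : ℕ) (W : {W : Set X // W ∈ 𝓝 x}) : {W : Set X // W ∈ 𝓝 x} :=
    ⟨W ∩ b k, inter_mem W.2 (hb.1.mem_of_mem trivial)⟩
  let W : ℕ → {W : Set X // W ∈ 𝓝 x} := fun k =>
    Nat.rec ⟨V, hV⟩ (fun k W => next (inter' k W)) k
  have hW (k : ℕ) : W (k + 1) = next (inter' k (W k)) := rfl
  have hanti : Antitone fun k => (W k).1 := antitone_nat_of_succ_le fun k => by
    rw [hW]; exact (hnext _).trans inter_subset_left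
  have hUk (k : ℕ) : U (inter' k (W k)) ⊆ (W k).1 :=
    (hUW _).trans (inter_subset_left (t := b k))
  have hd : ∀ i j, i < j → Disjoint (U (inter' i (W i))) (U (inter' j (W j))) := fun i j hij =>
    (hdisj (inter' i (W i))).mono_right
      ((hUk j).trans (hanti (Nat.succ_le_of_lt hij)))
  refine ⟨fun k => z (inter' k (W k)), fun k => U (inter' k (W k)), fun k => hzS _,
    fun k => hUo _, fun k => hzU _, fun k => (hUk k).trans (hanti (Nat.zero_le k)), ?_, ?_⟩
  · intro i j hij
    rcases lt_or_gt_of_ne hij with h | h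
    · exact hd i j h
    · exact (hd j i h).symm
  · intro A hA
    obtain ⟨k, -, hk⟩ := hb.1.mem_iff.1 hA
    filter_upwards [eventually_ge_atTop k] with j hj
    exact (hUW _).trans (inter_subset_right.trans ((hb.2 hj).trans hk))

/-! ### The homeomorphism underlying a multiplicative isomorphism -/

section Homeomorph

variable {E : Type*} [NormedAddCommGroup E] [InnerProductSpace ℝ E]
  {F : Type*} [NormedAddCommGroup F] [InnerProductSpace ℝ F] {r : ℕ}
  {N : Type*} [TopologicalSpace N] [ChartedSpace E N]
  {M : Type*} [TopologicalSpace M] [ChartedSpace F M]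

theorem ContMDiffMap.mul_eq_right_of_eqOn {g b : C^r⟮𝓘(ℝ, E), N; ℝ⟯} {U : Set N}
    (hg : ∀ z ∈ U, g z = 1) (hb : tsupport b ⊆ U) : g * b = b := by
  ext z
  by_cases hz : b z = 0
  · simp [hz]
  · simp [hg z (hb (subset_tsupport _ hz))]

theorem ContMDiffMap.eq_one_of_mul_eq_right {g b : C^r⟮𝓘(ℝ, E), N; ℝ⟯} (h : g * b = b) {z : N}
    (hz : b z ≠ 0) : g z = 1 := by
  have := DFunLike.congr_fun h z
  exact mul_right_cancel₀ hz (by simpa using this)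

/-- A multiplicative isomorphism `e` lies over the homeomorphism `φ` if the germ of `e g` at `y`
and the germ of `g` at `φ y` determine each other. -/
def LiesOver (e : C^r⟮𝓘(ℝ, E), N; ℝ⟯ ≃* C^r⟮𝓘(ℝ, F), M; ℝ⟯) (φ : M ≃ₜ N) : Prop :=
  ∀ (y : M) (g h : C^r⟮𝓘(ℝ, E), N; ℝ⟯), (g =ᶠ[𝓝 (φ y)] h) ↔ e g =ᶠ[𝓝 y] e h

theorem LiesOver.symm {e : C^r⟮𝓘(ℝ, E), N; ℝ⟯ ≃* C^r⟮𝓘(ℝ, F), M; ℝ⟯} {φ : M ≃ₜ N}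
    (h : LiesOver e φ) : LiesOver e.symm φ.symm := by
  intro x g k
  rw [← (φ.symm_apply_apply (φ.symm x))]
  have := h (φ.symm x) (e.symm g) (e.symm k)
  simpa using this.symm

/-- The function `e (-1)` has values `±1`, and its germ at `y` differs from that of `1`. -/
theorem LiesOver.apply_neg_one {e : C^r⟮𝓘(ℝ, E), N; ℝ⟯ ≃* C^r⟮𝓘(ℝ, F), M; ℝ⟯}
    {φ : M ≃ₜ N} (h : LiesOver e φ) (y : M) : e (-1) y = -1 := by
  have hsq : ∀ z, e (-1) z = 1 ∨ e (-1) z = -1 := by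
    intro z
    have h1 : e (-1) * e (-1) = 1 := by rw [← map_mul, neg_mul_neg, one_mul, map_one]
    exact mul_self_eq_one_iff.1 (DFunLike.congr_fun h1 z)
  refine (hsq y).resolve_left fun h1 => ?_
  have h2 : e (-1) =ᶠ[𝓝 y] e 1 := by
    filter_upwards [(e (-1)).contMDiff.continuous.continuousAt.eventually_const_lt
      (h1 ▸ one_pos : (0 : ℝ) < e (-1) y)] with z hz
    rw [map_one]
    refine (hsq z).resolve_right fun h3 => ?_
    rw [h3] at hz
    norm_num at hz
  have h3 : (-1 : ℝ) = 1 := ((h y _ _).2 h2).self_of_nhds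
  norm_num at h3

variable [FiniteDimensional ℝ E] [T2Space N] [IsManifold 𝓘(ℝ, E) r N]

theorem ContMDiffMap.exists_mul_eq_right {g : C^r⟮𝓘(ℝ, E), N; ℝ⟯} {x : N} (hg : g =ᶠ[𝓝 x] 1) :
    ∃ b : C^r⟮𝓘(ℝ, E), N; ℝ⟯, (b =ᶠ[𝓝 x] 1) ∧ g * b = b := by
  obtain ⟨b, hb1, hb⟩ := ContMDiffMap.exists_bump (E := E) (r := r) x hg
  exact ⟨b, hb1, mul_eq_right_of_eqOn (fun z hz => hz) hb⟩

/-- If there were no such point `y`, every `y` would have a neighbourhood on which `e g`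
vanishes for some `g` equal to `1` near `x`. For bumps `q k` with disjoint supports shrinking
to `x`, the sum of the functions `e (q (2 * k))` is then locally finite, so it is of class `C^r`;
its preimage under `e` equals `1` at the centres of the bumps of even index and `0` at the others,
and is discontinuous at `x`. -/
theorem MulEquiv.exists_forall_eventuallyEq_one [Nontrivial E]
    (e : C^r⟮𝓘(ℝ, E), N; ℝ⟯ ≃* C^r⟮𝓘(ℝ, F), M; ℝ⟯) (x : N) :
    ∃ y : M, ∀ g : C^r⟮𝓘(ℝ, E), N; ℝ⟯, (g =ᶠ[𝓝 x] 1) → e g =ᶠ[𝓝 y] 1 := by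
  by_contra! hcon
  -- if `g * b = b` and `b * c = c`, then `e g = 1` near the support of `e c`
  have h0 : ∀ y : M, ∃ g : C^r⟮𝓘(ℝ, E), N; ℝ⟯, (g =ᶠ[𝓝 x] 1) ∧ e g =ᶠ[𝓝 y] 0 := by
    intro y
    obtain ⟨g, hg, hgy⟩ := hcon y
    obtain ⟨b, hb, hgb⟩ := ContMDiffMap.exists_mul_eq_right hg
    obtain ⟨c, hc, hbc⟩ := ContMDiffMap.exists_mul_eq_right hb
    refine ⟨c, hc, ?_⟩
    rw [← notMem_tsupport_iff_eventuallyEq]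
    intro hy
    have hgb' : e g * e b = e b := by rw [← map_mul, hgb]
    have hbc' : e b * e c = e c := by rw [← map_mul, hbc]
    have hclosed : IsClosed {z | e b z = 1} := isClosed_eq (e b).contMDiff.continuous
      continuous_const
    have hby : e b y = 1 := closure_minimal
      (fun z hz => ContMDiffMap.eq_one_of_mul_eq_right hbc' hz) hclosed hy
    apply hgy
    filter_upwards [(e b).contMDiff.continuous.continuousAt.eventually_ne
      (hby.trans_ne one_ne_zero)] with z hz
    exact ContMDiffMap.eq_one_of_mul_eq_right hgb' hz
  have := isCountablyGenerated_nhds_of_chartedSpace E x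
  have := nhdsNE_neBot_of_chartedSpace E x
  obtain ⟨z, U, -, hUo, hzU, -, hd, hU⟩ := exists_seq_pairwise_disjoint_nhds (x := x) (S := univ)
    (frequently_true_iff_neBot _ |>.2 this) univ_mem
  choose q hq1 hq using fun k =>
    ContMDiffMap.exists_bump (E := E) (r := r) (z k) ((hUo k).mem_nhds (hzU k))
  have hqq : ∀ i j, i ≠ j → q i * q j = 0 := by
    intro i j hij
    ext w
    by_contra hw
    have hw : q i w ≠ 0 ∧ q j w ≠ 0 := by simpa using hw
    exact (hd hij).le_bot ⟨hq i (subset_tsupport _ hw.1), hq j (subset_tsupport _ hw.2)⟩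
  have heqq : ∀ i j, i ≠ j → ∀ y, e (q i) y = 0 ∨ e (q j) y = 0 := by
    intro i j hij y
    have h1 : e (q i) * e (q j) = 0 := by rw [← map_mul, hqq i j hij, map_zero]
    simpa using DFunLike.congr_fun h1 y
  have hfin : LocallyFinite fun k => Function.support (e (q (2 * k))) := by
    intro y
    obtain ⟨g, hg1, hg0⟩ := h0 y
    refine ⟨_, hg0, ?_⟩
    obtain ⟨K, hK⟩ := eventually_atTop.1 (hU _ hg1)
    refine (finite_lt_nat K).subset ?_
    rintro k ⟨w, hw, hw0⟩
    by_contra hk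
    have hk : K ≤ 2 * k := by simp only [mem_ofPred_eq, not_lt] at hk; lia
    have h1 : g * q (2 * k) = q (2 * k) :=
      ContMDiffMap.mul_eq_right_of_eqOn (fun z hz => hK _ hk hz) (hq _)
    apply hw
    rw [← h1, map_mul]
    have hw0 : e g w = 0 := hw0
    simp [hw0]
  let v : C^r⟮𝓘(ℝ, F), M; ℝ⟯ :=
    ⟨fun y => ∑ᶠ k, e (q (2 * k)) y, contMDiff_finsum (fun k => (e (q (2 * k))).contMDiff) hfin⟩
  have hv : ∀ y, v y = ∑ᶠ k, e (q (2 * k)) y := fun y => rfl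
  have heven : ∀ k, e.symm v (z (2 * k)) = 1 := by
    intro k
    have h1 : e.symm v * q (2 * k) = q (2 * k) * q (2 * k) := by
      apply e.injective
      rw [map_mul, map_mul, e.apply_symm_apply]
      ext y
      by_cases hy : e (q (2 * k)) y = 0
      · simp [hy]
      · have : v y = e (q (2 * k)) y := by
          rw [hv]
          exact finsum_eq_single _ k fun j hj => (heqq (2 * j) (2 * k) (by lia) y).resolve_right hy
        simp [this]
    have h2 : q (2 * k) (z (2 * k)) = 1 := (hq1 _).self_of_nhds
    simpa [h2] using DFunLike.congr_fun h1 (z (2 * k))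
  have hodd : ∀ k, e.symm v (z (2 * k + 1)) = 0 := by
    intro k
    have h1 : e.symm v * q (2 * k + 1) = 0 := by
      apply e.injective
      rw [map_mul, e.apply_symm_apply, map_zero]
      ext y
      by_cases hy : e (q (2 * k + 1)) y = 0
      · simp [hy]
      · have : v y = 0 := by
          rw [hv]
          exact finsum_eq_zero_of_forall_eq_zero fun j =>
            (heqq (2 * j) (2 * k + 1) (by lia) y).resolve_right hy
        simp [this]
    have h2 : q (2 * k + 1) (z (2 * k + 1)) = 1 := (hq1 _).self_of_nhds
    simpa [h2] using DFunLike.congr_fun h1 (z (2 * k + 1))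
  have hz : Tendsto z atTop (𝓝 x) := fun W hW => (hU W hW).mono fun k hk => hk (hzU k)
  have hlim : Tendsto (fun k => e.symm v (z k)) atTop (𝓝 (e.symm v x)) :=
    ((e.symm v).contMDiff.continuous.tendsto x).comp hz
  have he : Tendsto (fun k : ℕ => 2 * k) atTop atTop :=
    tendsto_atTop_mono (fun k => by simp only [id]; lia) tendsto_id
  have ho : Tendsto (fun k : ℕ => 2 * k + 1) atTop atTop :=
    tendsto_atTop_mono (fun k => by simp only [id]; lia) tendsto_id
  have l1 : e.symm v x = 1 := tendsto_nhds_unique (hlim.comp he)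
    (by simp only [Function.comp_def, heven]; exact tendsto_const_nhds)
  have l2 : e.symm v x = 0 := tendsto_nhds_unique (hlim.comp ho)
    (by simp only [Function.comp_def, hodd]; exact tendsto_const_nhds)
  exact one_ne_zero (l1.symm.trans l2)

/-- Equality of germs is expressed by multiplication and the functions equal to `1` near `x`. -/
theorem ContMDiffMap.eventuallyEq_iff {x : N} {g h : C^r⟮𝓘(ℝ, E), N; ℝ⟯} :
    (g =ᶠ[𝓝 x] h) ↔ ∃ b : C^r⟮𝓘(ℝ, E), N; ℝ⟯, (b =ᶠ[𝓝 x] 1) ∧ b * g = b * h := by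
  constructor
  · intro hgh
    obtain ⟨b, hb1, hb⟩ := ContMDiffMap.exists_bump (E := E) (r := r) x hgh
    refine ⟨b, hb1, ?_⟩
    ext z
    by_cases hz : b z = 0
    · simp [hz]
    · have : g z = h z := hb (subset_tsupport _ hz)
      simp [this]
  · rintro ⟨b, hb1, hb⟩
    filter_upwards [hb1] with z hz
    simpa [hz] using DFunLike.congr_fun hb z

theorem ContMDiffMap.ne_zero_iff_exists_mul_eventuallyEq_one {x : N}
    {g : C^r⟮𝓘(ℝ, E), N; ℝ⟯} :
    g x ≠ 0 ↔ ∃ h : C^r⟮𝓘(ℝ, E), N; ℝ⟯, ⇑(g * h) =ᶠ[𝓝 x] ⇑(1 : C^r⟮𝓘(ℝ, E), N; ℝ⟯) := by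
  constructor
  · intro hg
    obtain ⟨h, hh⟩ := ContMDiffMap.exists_eventuallyEq (g.contMDiff.contMDiffAt.inv₀ hg)
    refine ⟨h, ?_⟩
    filter_upwards [hh, g.contMDiff.continuous.continuousAt.eventually_ne hg] with z hz hz0
    simp [hz, hz0]
  · rintro ⟨h, hh⟩ h0
    have := hh.self_of_nhds
    simp [h0] at this

variable [FiniteDimensional ℝ F] [T2Space M] [IsManifold 𝓘(ℝ, F) r M]

theorem MulEquiv.ne_zero_iff_of_forall_eventuallyEq_iff
    {e : C^r⟮𝓘(ℝ, E), N; ℝ⟯ ≃* C^r⟮𝓘(ℝ, F), M; ℝ⟯} {x : N} {y : M}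
    (he : ∀ g h : C^r⟮𝓘(ℝ, E), N; ℝ⟯, (g =ᶠ[𝓝 x] h) ↔ e g =ᶠ[𝓝 y] e h)
    {g : C^r⟮𝓘(ℝ, E), N; ℝ⟯} : g x ≠ 0 ↔ e g y ≠ 0 := by
  rw [ContMDiffMap.ne_zero_iff_exists_mul_eventuallyEq_one,
    ContMDiffMap.ne_zero_iff_exists_mul_eventuallyEq_one]
  constructor
  · rintro ⟨k, hk⟩
    exact ⟨e k, by simpa using (he _ _).1 hk⟩
  · rintro ⟨k, hk⟩
    exact ⟨e.symm k, by rw [he]; simpa using hk⟩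

theorem MulEquiv.exists_liesOver [Nontrivial E] [Nontrivial F]
    (e : C^r⟮𝓘(ℝ, E), N; ℝ⟯ ≃* C^r⟮𝓘(ℝ, F), M; ℝ⟯) : ∃ φ : M ≃ₜ N, LiesOver e φ := by
  choose τ hτ using e.exists_forall_eventuallyEq_one
  choose σ hσ using e.symm.exists_forall_eventuallyEq_one
  have hστ : ∀ x, σ (τ x) = x := by
    intro x
    by_contra hne
    obtain ⟨b, hb1, hb⟩ := ContMDiffMap.exists_bump (E := E) (r := r) x
      (isOpen_compl_singleton.mem_nhds (Ne.symm hne))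
    have h1 := (hσ _ _ (hτ x b hb1)).self_of_nhds
    rw [e.symm_apply_apply] at h1
    exact hb (subset_tsupport _ (h1.trans_ne one_ne_zero)) rfl
  have hτσ : ∀ y, τ (σ y) = y := by
    intro y
    by_contra hne
    obtain ⟨b, hb1, hb⟩ := ContMDiffMap.exists_bump (E := F) (r := r) y
      (isOpen_compl_singleton.mem_nhds (Ne.symm hne))
    have h1 := (hτ _ _ (hσ y b hb1)).self_of_nhds
    rw [e.apply_symm_apply] at h1
    exact hb (subset_tsupport _ (h1.trans_ne one_ne_zero)) rfl
  have hgerm : ∀ (y : M) (g h : C^r⟮𝓘(ℝ, E), N; ℝ⟯),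
      (g =ᶠ[𝓝 (σ y)] h) ↔ e g =ᶠ[𝓝 y] e h := by
    intro y g h
    rw [ContMDiffMap.eventuallyEq_iff, ContMDiffMap.eventuallyEq_iff]
    constructor
    · rintro ⟨b, hb1, hb⟩
      refine ⟨e b, ?_, by rw [← map_mul, ← map_mul, hb]⟩
      simpa [hτσ] using hτ _ b hb1
    · rintro ⟨b, hb1, hb⟩
      refine ⟨e.symm b, hσ y b hb1, e.injective ?_⟩
      rw [map_mul, map_mul, e.apply_symm_apply, hb]
  have hne : ∀ y g, g (σ y) ≠ 0 ↔ e g y ≠ 0 := fun y _ =>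
    MulEquiv.ne_zero_iff_of_forall_eventuallyEq_iff (hgerm y)
  have hσc : Continuous σ := by
    rw [continuous_iff_continuousAt]
    intro y U hU
    obtain ⟨b, hb1, hb⟩ := ContMDiffMap.exists_bump (E := E) (r := r) (σ y) hU
    have hb0 : b (σ y) ≠ 0 := hb1.self_of_nhds.trans_ne one_ne_zero
    rw [mem_map]
    filter_upwards [(e b).contMDiff.continuous.continuousAt.eventually_ne ((hne _ _).1 hb0)]
      with w hw
    exact hb (subset_tsupport _ ((hne _ _).2 hw))
  have hτc : Continuous τ := by
    rw [continuous_iff_continuousAt]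
    intro x U hU
    obtain ⟨b, hb1, hb⟩ := ContMDiffMap.exists_bump (E := F) (r := r) (τ x) hU
    have hb0 : e (e.symm b) (τ x) ≠ 0 := by
      rw [e.apply_symm_apply]; exact hb1.self_of_nhds.trans_ne one_ne_zero
    have hb0' := (hne _ _).2 hb0
    rw [hστ] at hb0'
    rw [mem_map]
    filter_upwards [(e.symm b).contMDiff.continuous.continuousAt.eventually_ne hb0'] with w hw
    rw [← hστ w, hne, e.apply_symm_apply] at hw
    exact hb (subset_tsupport _ hw)
  exact ⟨⟨⟨σ, τ, hτσ, hστ⟩, hσc, hτc⟩, hgerm⟩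

namespace LiesOver

variable {e : C^r⟮𝓘(ℝ, E), N; ℝ⟯ ≃* C^r⟮𝓘(ℝ, F), M; ℝ⟯} {φ : M ≃ₜ N}

theorem ne_zero_iff (h : LiesOver e φ) {y : M} {g : C^r⟮𝓘(ℝ, E), N; ℝ⟯} :
    g (φ y) ≠ 0 ↔ e g y ≠ 0 :=
  MulEquiv.ne_zero_iff_of_forall_eventuallyEq_iff (h y)

/-- A function is positive at a point if and only if its germ there is the square of an invertible
germ. -/
theorem pos (h : LiesOver e φ) {y : M} {g : C^r⟮𝓘(ℝ, E), N; ℝ⟯} (hg : 0 < g (φ y)) :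
    0 < e g y := by
  have h1 : ContMDiffAt 𝓘(ℝ, E) 𝓘(ℝ) r (fun z => Real.sqrt (g z)) (φ y) :=
    (Real.contDiffAt_sqrt hg.ne').contMDiffAt.comp _ g.contMDiff.contMDiffAt
  obtain ⟨k, hk⟩ := ContMDiffMap.exists_eventuallyEq h1
  have h2 : g =ᶠ[𝓝 (φ y)] ⇑(k * k) := by
    filter_upwards [hk, g.contMDiff.continuous.continuousAt.eventually_const_lt hg] with z hz hz0
    simp [hz, Real.mul_self_sqrt hz0.le]
  have h3 := ((h _ _ _).1 h2).self_of_nhds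
  have h4 : e k y ≠ 0 := h.ne_zero_iff.1 (by
    rw [hk.self_of_nhds]; exact (Real.sqrt_pos.2 hg).ne')
  rw [h3, map_mul]
  exact mul_self_pos.2 h4

end LiesOver

end Homeomorph

/-! ### Rapidly decaying exponentials concentrated near a sequence of points -/

section Series

variable {E : Type*} [NormedAddCommGroup E] [NormedSpace ℝ E]

theorem ContDiff.exists_norm_iteratedFDeriv_le {r : ℕ} {f : E → ℝ} (hf : ContDiff ℝ r f)
    (hc : HasCompactSupport f) :
    ∃ C : ℝ, 1 ≤ C ∧ ∀ i ≤ r, ∀ x, ‖iteratedFDeriv ℝ i f x‖ ≤ C := by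
  have h1 : ∀ i, ∃ C : ℝ, i ≤ r → ∀ x, ‖iteratedFDeriv ℝ i f x‖ ≤ C := by
    intro i
    by_cases hi : i ≤ r
    · obtain ⟨C, hC⟩ := (hf.continuous_iteratedFDeriv (m := i)
        (by exact_mod_cast hi)).bounded_above_of_compact_support (hc.iteratedFDeriv i)
      exact ⟨C, fun _ => hC⟩
    · exact ⟨0, fun h => absurd h hi⟩
  choose C hC using h1
  refine ⟨1 + ∑ i ∈ Finset.range (r + 1), |C i|,
    le_add_of_nonneg_right (Finset.sum_nonneg fun _ _ => abs_nonneg _), fun i hi x => ?_⟩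
  have h2 : |C i| ≤ ∑ i ∈ Finset.range (r + 1), |C i| :=
    Finset.single_le_sum (f := fun i => |C i|) (fun _ _ => abs_nonneg _)
      (Finset.mem_range.2 (Nat.lt_succ_of_le hi))
  linarith [hC i hi x, le_abs_self (C i)]

/-- The derivatives up to order `r` of `χ * θ (n * w - q)` grow at most like `n ^ r`, uniformly in
the shift `q`. -/
theorem exists_norm_iteratedFDeriv_mul_comp_le {r : ℕ} {χ w : E → ℝ} {θ : ℝ → ℝ}
    (hχ : ContDiff ℝ r χ) (hχc : HasCompactSupport χ) (hw : ContDiff ℝ r w)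
    (hwc : HasCompactSupport w) (hθ : ContDiff ℝ r θ) (hθc : HasCompactSupport θ) :
    ∃ C : ℝ, ∀ (n : ℕ) (q : ℝ), ∀ j ≤ r, ∀ x,
      ‖iteratedFDeriv ℝ j (fun x => χ x * θ (n * w x - q)) x‖ ≤ C * (n + 1 : ℝ) ^ r := by
  obtain ⟨A, hA1, hA⟩ := hχ.exists_norm_iteratedFDeriv_le hχc
  obtain ⟨B, hB1, hB⟩ := hw.exists_norm_iteratedFDeriv_le hwc
  obtain ⟨D, hD1, hD⟩ := hθ.exists_norm_iteratedFDeriv_le hθc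
  have hcomp : ∀ (n : ℕ) (q : ℝ), ∀ j ≤ r, ∀ x,
      ‖iteratedFDeriv ℝ j (fun x => θ (n * w x - q)) x‖ ≤
        r.factorial * D * (B ^ r * (n + 1 : ℝ) ^ r) := by
    intro n q j hj x
    have hg : ContDiff ℝ r (fun x => n * w x - q) := (contDiff_const.mul hw).sub contDiff_const
    have hBn : 1 ≤ B * (n + 1 : ℝ) := one_le_mul_of_one_le_of_one_le hB1 (by simp)
    have h1 := norm_iteratedFDeriv_comp_le (g := θ) (f := fun x => n * w x - q) hθ hg
      (n := j) (by exact_mod_cast hj) x (C := D) (D := B * (n + 1))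
      (fun i hi => hD i (hi.trans hj) _) (fun i hi1 hi => by
        have h2 : iteratedFDeriv ℝ i (fun x => n * w x - q) x
            = (n : ℝ) • iteratedFDeriv ℝ i w x := by
          have hw' : ContDiff ℝ i w := hw.of_le (by exact_mod_cast hi.trans hj)
          rw [fun_iteratedFDeriv_sub_apply (contDiff_const.mul hw').contDiffAt contDiffAt_const,
            iteratedFDeriv_const_of_ne (by lia)]
          simp only [Pi.zero_apply, sub_zero]
          exact iteratedFDeriv_const_smul_apply (a := (n : ℝ)) hw'.contDiffAt
        rw [h2, norm_smul, Real.norm_natCast]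
        calc (n : ℝ) * ‖iteratedFDeriv ℝ i w x‖ ≤ (n + 1) * B := by
              gcongr
              · linarith
              · exact hB i (hi.trans hj) x
          _ = B * (n + 1) := mul_comm _ _
          _ ≤ (B * (n + 1)) ^ i := le_self_pow₀ hBn (by lia))
    refine h1.trans ?_
    rw [← mul_pow]
    gcongr
  refine ⟨2 ^ r * A * (r.factorial * D * B ^ r), fun n q j hj x => ?_⟩
  have hg : ContDiff ℝ r (fun x => θ (n * w x - q)) :=
    hθ.comp ((contDiff_const.mul hw).sub contDiff_const)
  refine (norm_iteratedFDeriv_mul_le hχ hg x (n := j) (by exact_mod_cast hj)).trans ?_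
  calc ∑ i ∈ Finset.range (j + 1), (j.choose i : ℝ) * ‖iteratedFDeriv ℝ i χ x‖ *
        ‖iteratedFDeriv ℝ (j - i) (fun x => θ (n * w x - q)) x‖
      ≤ ∑ i ∈ Finset.range (j + 1), (j.choose i : ℝ) * A *
        (r.factorial * D * (B ^ r * (n + 1 : ℝ) ^ r)) := by
        refine Finset.sum_le_sum fun i hi => ?_
        have hi' : i ≤ j := Nat.lt_succ_iff.1 (Finset.mem_range.1 hi)
        gcongr
        · exact hA i (hi'.trans hj) x
        · exact hcomp n q (j - i) ((Nat.sub_le _ _).trans hj) x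
    _ = 2 ^ j * A * (r.factorial * D * (B ^ r * (n + 1 : ℝ) ^ r)) := by
        rw [← Finset.sum_mul, ← Finset.sum_mul]
        congr 2
        exact_mod_cast Nat.sum_range_choose j
    _ ≤ 2 ^ r * A * (r.factorial * D * (B ^ r * (n + 1 : ℝ) ^ r)) := by
        gcongr
        norm_num
    _ = _ := by ring

/-- With `n = L ^ 2`, the factor `exp (-L)` beats every power of `n` while `n` beats `L`. -/
theorem exists_exp_neg_mul_pow_le_and_lt (r : ℕ) (C P : ℝ) {δ ε : ℝ} (hδ : 0 < δ) (hε : 0 < ε) :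
    ∃ n L : ℕ, Real.exp (-L) * (C * (n + 1 : ℝ) ^ r) ≤ ε ∧ P * (1 + L) < n * δ := by
  have h1 : Tendsto (fun L : ℝ => Real.exp (-L) * (C * (L ^ 2 + 1) ^ r)) atTop (𝓝 0) := by
    have h2 := ((Real.tendsto_pow_mul_exp_neg_atTop_nhds_zero (2 * r)).comp
      (tendsto_atTop_add_const_right atTop (1 : ℝ) tendsto_id)).const_mul (|C| * Real.exp 1)
    rw [mul_zero] at h2
    refine squeeze_zero_norm' ?_ h2
    filter_upwards [eventually_ge_atTop 0] with L hL
    rw [Real.norm_eq_abs, abs_mul, abs_mul, abs_pow, Real.abs_exp, abs_of_nonneg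
      (by positivity : 0 ≤ L ^ 2 + 1)]
    have h3 : Real.exp (-L) = Real.exp 1 * Real.exp (-(L + 1)) := by
      rw [← Real.exp_add]; congr 1; ring
    have h4 : (L ^ 2 + 1) ^ r ≤ (L + 1) ^ (2 * r) := by
      rw [pow_mul]
      gcongr
      nlinarith
    calc Real.exp (-L) * (|C| * (L ^ 2 + 1) ^ r)
        ≤ Real.exp (-L) * (|C| * (L + 1) ^ (2 * r)) := by gcongr
      _ = _ := by simp only [h3, Function.comp_apply, id]; ring
  have h5 : Tendsto (fun L : ℝ => L * (L * δ - P)) atTop atTop :=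
    tendsto_id.atTop_mul_atTop₀ (tendsto_atTop_add_const_right atTop (-P)
      (tendsto_id.atTop_mul_const hδ))
  obtain ⟨L, hL1, hL2⟩ := (((h1.comp tendsto_natCast_atTop_atTop).eventually_le_const hε).and
    ((h5.comp tendsto_natCast_atTop_atTop).eventually_gt_atTop P)).exists
  refine ⟨L ^ 2, L, by simpa using hL1, ?_⟩
  simp only [Function.comp_apply] at hL2
  push_cast
  linarith

theorem ContDiffBump.exists_tsupport_subset [FiniteDimensional ℝ E] {a : E} {O : Set E}
    (hO : O ∈ 𝓝 a) : ∃ χ : ContDiffBump a, tsupport χ ⊆ O := by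
  obtain ⟨ρ, hρ, hsub⟩ := Metric.nhds_basis_closedBall.mem_iff.1 hO
  exact ⟨⟨ρ / 2, ρ, by linarith, by linarith⟩, by rw [ContDiffBump.tsupport_eq]; exact hsub⟩

/-- There is a `C^r` function equal to `exp (n k * w k - round (n k * w k (a k)) - L k)` near `a k`
for all `k`, with `n k` as large as desired compared to `L k`. The integer `round (n k * w k (a k))`
keeps the exponent bounded near `a k` up to the term `L k`, so that the derivatives up to order
`r` of the cut-off exponential are of the size `exp (-L k) * n k ^ r`. -/
theorem exists_contDiff_eventuallyEq_exp [FiniteDimensional ℝ E] (r : ℕ) (a : ℕ → E)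
    (O : ℕ → Set E) (hO : ∀ k, IsOpen (O k)) (ha : ∀ k, a k ∈ O k)
    (hd : Pairwise (Function.onFun Disjoint O)) (w : ℕ → E → ℝ)
    (hw : ∀ k, ContDiffAt ℝ r (w k) (a k)) (P δ : ℕ → ℝ) (hδ : ∀ k, 0 < δ k) :
    ∃ (f : E → ℝ) (n L : ℕ → ℕ), ContDiff ℝ r f ∧
      (∀ k, f =ᶠ[𝓝 (a k)]
        fun x => Real.exp (n k * w k x - round (n k * w k (a k)) - L k)) ∧
      (∀ k, |f (a k)| ≤ (1 / 2) ^ k) ∧ ∀ k, P k * (1 + L k) < n k * δ k := by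
  -- `θ` agrees with the exponential on `[-1, 1]` and has bounded derivatives
  let β : ContDiffBump (0 : ℝ) := ⟨1, 2, by norm_num, by norm_num⟩
  let θ : ℝ → ℝ := fun t => β t * Real.exp t
  have hθ : ContDiff ℝ r θ := β.contDiff.mul Real.contDiff_exp
  have hθc : HasCompactSupport θ := β.hasCompactSupport.mul_right
  have hnhds : ∀ k, {x | ContDiffAt ℝ r (w k) x} ∩ O k ∈ 𝓝 (a k) := fun k =>
    inter_mem ((hw k).eventually (by simp)) ((hO k).mem_nhds (ha k))
  choose χ hχ using fun k => ContDiffBump.exists_tsupport_subset (hnhds k)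
  have hχw : ∀ k, ContDiff ℝ r fun x => χ k x * w k x := by
    intro k
    rw [← contMDiff_iff_contDiff]
    refine contMDiff_of_tsupport fun x hx => ?_
    exact ((χ k).contDiff.contDiffAt.mul (hχ k (tsupport_mul_subset_left hx)).1).contMDiffAt
  choose C hC using fun k => exists_norm_iteratedFDeriv_mul_comp_le (r := r)
    (χ k).contDiff (χ k).hasCompactSupport (hχw k) (χ k).hasCompactSupport.mul_right hθ hθc
  choose n L hnL hP using fun k => exists_exp_neg_mul_pow_le_and_lt r (C k) (P k) (hδ k)
    (show (0 : ℝ) < (1 / 2) ^ k by positivity)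
  let q : ℕ → ℝ := fun k => round (n k * w k (a k))
  let G : ℕ → E → ℝ := fun k x => χ k x * θ (n k * (χ k x * w k x) - q k)
  have hG : ∀ k, ContDiff ℝ r (G k) := fun k =>
    (χ k).contDiff.mul (hθ.comp ((contDiff_const.mul (hχw k)).sub contDiff_const))
  have hbound : ∀ k, ∀ j ≤ r, ∀ x,
      ‖iteratedFDeriv ℝ j (fun x => Real.exp (-L k) * G k x) x‖ ≤ (1 / 2) ^ k := by
    intro k j hj x
    have h1 : iteratedFDeriv ℝ j (fun x => Real.exp (-L k) * G k x) x
        = Real.exp (-L k) • iteratedFDeriv ℝ j (G k) x :=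
      iteratedFDeriv_const_smul_apply (a := Real.exp (-L k)) ((hG k).of_le (by exact_mod_cast hj)).contDiffAt
    rw [h1, norm_smul, Real.norm_eq_abs, Real.abs_exp]
    exact (mul_le_mul_of_nonneg_left (hC k (n k) (q k) j hj x) (Real.exp_pos _).le).trans (hnL k)
  have hsingle : ∀ k, ∀ x ∈ O k,
      ∑' i, Real.exp (-L i) * G i x = Real.exp (-L k) * G k x := by
    intro k x hx
    refine tsum_eq_single k fun i hi => ?_
    have h0 : χ i x = 0 := by
      by_contra h0
      exact (hd hi).le_bot ⟨(hχ i (subset_tsupport _ h0)).2, hx⟩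
    simp [G, h0]
  refine ⟨fun x => ∑' k, Real.exp (-L k) * G k x, n, L, ?_, ?_, ?_, hP⟩
  · refine contDiff_tsum (𝕜 := ℝ) (N := (r : ℕ∞)) (v := fun _ k => (1 / 2 : ℝ) ^ k)
      (fun k => contDiff_const.mul (hG k)) (fun _ _ => summable_geometric_two) ?_
    intro j k x hj
    exact hbound k j (by exact_mod_cast hj) x
  · intro k
    have hclose : ∀ᶠ x in 𝓝 (a k), n k * w k x - q k ∈ Metric.ball (0 : ℝ) 1 := by
      have hcont : ContinuousAt (fun x => n k * w k x - q k) (a k) :=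
        (continuousAt_const.mul (hw k).continuousAt).sub continuousAt_const
      refine hcont.eventually_mem (Metric.isOpen_ball.mem_nhds ?_)
      rw [mem_ball_zero_iff, Real.norm_eq_abs]
      exact (abs_sub_round _).trans_lt (by norm_num)
    filter_upwards [hclose, (χ k).eventuallyEq_one, (hO k).mem_nhds (ha k)] with x hx hx1 hxO
    have hβ : β (n k * w k x - q k) = 1 := β.one_of_mem_closedBall (Metric.ball_subset_closedBall hx)
    have hx1 : χ k x = 1 := hx1
    simp only [hsingle k x hxO, G, hx1, one_mul, θ, hβ]
    rw [← Real.exp_add]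
    congr 1
    ring
  · intro k
    beta_reduce
    rw [hsingle k _ (ha k), ← Real.norm_eq_abs,
      ← norm_iteratedFDeriv_zero (𝕜 := ℝ) (f := fun x => Real.exp (-L k) * G k x)]
    exact hbound k 0 (Nat.zero_le r) (a k)

end Series

section Interpolation

variable {E : Type*} [NormedAddCommGroup E] [InnerProductSpace ℝ E] [FiniteDimensional ℝ E]
  {N : Type*} [TopologicalSpace N] [T2Space N] [ChartedSpace E N] {r : ℕ}
  [IsManifold 𝓘(ℝ, E) r N]

/-- The manifold version of `exists_contDiff_eventuallyEq_exp`, for points `z k` tending to `x`. -/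
theorem ContMDiffMap.exists_eventuallyEq_exp {x : N} {z : ℕ → N} {U : ℕ → Set N}
    (hU : ∀ k, IsOpen (U k)) (hz : ∀ k, z k ∈ U k) (hUx : ∀ k, U k ⊆ (chartAt E x).source)
    (hd : Pairwise (Function.onFun Disjoint U)) (hzx : Tendsto z atTop (𝓝 x))
    (w : ℕ → C^r⟮𝓘(ℝ, E), N; ℝ⟯) (P δ : ℕ → ℝ) (hδ : ∀ k, 0 < δ k) :
    ∃ (f : C^r⟮𝓘(ℝ, E), N; ℝ⟯) (n L : ℕ → ℕ), f x = 0 ∧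
      (∀ᶠ k in atTop, f =ᶠ[𝓝 (z k)]
        fun v => Real.exp (n k * w k v - round (n k * w k (z k)) - L k)) ∧
      ∀ k, P k * (1 + L k) < n k * δ k := by
  set c := chartAt E x
  have hzc : ∀ k, z k ∈ c.source := fun k => hUx k (hz k)
  have hw : ∀ k, ContDiffAt ℝ r (w k ∘ c.symm) (c (z k)) := by
    intro k
    rw [← contMDiffAt_iff_contDiffAt]
    refine (w k).contMDiff.contMDiffAt.comp _ ?_
    exact (contMDiffOn_chart_symm (I := 𝓘(ℝ, E))).contMDiffAt
      (c.open_target.mem_nhds (c.map_source (hzc k)))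
  obtain ⟨g, n, L, hg, hgz, hg0, hP⟩ := exists_contDiff_eventuallyEq_exp r (fun k => c (z k))
    (fun k => c.target ∩ c.symm ⁻¹' U k) (fun k => c.isOpen_inter_preimage_symm (hU k))
    (fun k => ⟨c.map_source (hzc k), by simpa [c.left_inv (hzc k)] using hz k⟩)
    (fun i j hij => ((hd hij).preimage c.symm).mono inter_subset_right inter_subset_right)
    (fun k => w k ∘ c.symm) hw P δ hδ
  have hgc : ContMDiffAt 𝓘(ℝ, E) 𝓘(ℝ) r (g ∘ c) x :=
    hg.contMDiff.contMDiffAt.comp x ((contMDiffOn_chart (I := 𝓘(ℝ, E))).contMDiffAt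
      (c.open_source.mem_nhds (mem_chart_source E x)))
  obtain ⟨f, hf⟩ := ContMDiffMap.exists_eventuallyEq hgc
  have hfz : ∀ᶠ k in atTop, f =ᶠ[𝓝 (z k)] (g ∘ c) := hzx.eventually hf.eventually_nhds
  refine ⟨f, n, L, ?_, ?_, hP⟩
  · refine tendsto_nhds_unique ((f.contMDiff.continuous.tendsto x).comp hzx)
      (squeeze_zero_norm' ?_ (tendsto_pow_atTop_nhds_zero_of_lt_one
        (by norm_num : (0 : ℝ) ≤ 1 / 2) (by norm_num)))
    filter_upwards [hfz] with k hk
    rw [Function.comp_apply, hk.self_of_nhds]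
    exact hg0 k
  · filter_upwards [hfz] with k hk
    have h1 := (c.continuousAt (hzc k)).eventually (hgz k)
    filter_upwards [hk, h1, c.open_source.mem_nhds (hzc k)] with v hv hv1 hvc
    rw [hv, Function.comp_apply, hv1]
    simp [c.left_inv hvc, c.left_inv (hzc k)]

end Interpolation

/-! ### Multiplicative isomorphisms on positive functions -/

section Positive

variable {E : Type*} [NormedAddCommGroup E] [InnerProductSpace ℝ E]
  {F : Type*} [NormedAddCommGroup F] [InnerProductSpace ℝ F] {r : ℕ}
  {N : Type*} [TopologicalSpace N] [ChartedSpace E N]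
  {M : Type*} [TopologicalSpace M] [ChartedSpace F M]

/-- The exponential of a real-valued `C^r` function. -/
noncomputable def ContMDiffMap.rexp (u : C^r⟮𝓘(ℝ, E), N; ℝ⟯) : C^r⟮𝓘(ℝ, E), N; ℝ⟯ :=
  ⟨fun x => Real.exp (u x), Real.contDiff_exp.contMDiff.comp u.contMDiff⟩

theorem ContMDiffMap.rexp_apply (u : C^r⟮𝓘(ℝ, E), N; ℝ⟯) (x : N) :
    ContMDiffMap.rexp u x = Real.exp (u x) := rfl

theorem ContMDiffMap.rexp_add (u v : C^r⟮𝓘(ℝ, E), N; ℝ⟯) :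
    ContMDiffMap.rexp (u + v) = ContMDiffMap.rexp u * ContMDiffMap.rexp v := by
  ext x
  simp [rexp_apply, Real.exp_add]

variable [FiniteDimensional ℝ E] [T2Space N] [IsManifold 𝓘(ℝ, E) r N]
  [FiniteDimensional ℝ F] [T2Space M] [IsManifold 𝓘(ℝ, F) r M]
  {e : C^r⟮𝓘(ℝ, E), N; ℝ⟯ ≃* C^r⟮𝓘(ℝ, F), M; ℝ⟯} {φ : M ≃ₜ N}

namespace LiesOver

theorem rexp_pos (h : LiesOver e φ) (u : C^r⟮𝓘(ℝ, E), N; ℝ⟯) (y : M) :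
    0 < e (ContMDiffMap.rexp u) y :=
  h.pos (Real.exp_pos _)

/-- The additive map `u ↦ log (e (exp u) y)`, the multiplicative isomorphism `e` evaluated at `y`
in logarithmic coordinates. -/
noncomputable def logHom (h : LiesOver e φ) (y : M) : C^r⟮𝓘(ℝ, E), N; ℝ⟯ →+ ℝ :=
  AddMonoidHom.mk' (fun u => Real.log (e (ContMDiffMap.rexp u) y)) fun u v => by
    rw [ContMDiffMap.rexp_add, map_mul, ContMDiffMap.coe_mul, Pi.mul_apply,
      Real.log_mul (h.rexp_pos u y).ne' (h.rexp_pos v y).ne']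

theorem exp_logHom (h : LiesOver e φ) (y : M) (u : C^r⟮𝓘(ℝ, E), N; ℝ⟯) :
    Real.exp (h.logHom y u) = e (ContMDiffMap.rexp u) y :=
  Real.exp_log (h.rexp_pos u y)

theorem continuous_logHom (h : LiesOver e φ) (u : C^r⟮𝓘(ℝ, E), N; ℝ⟯) :
    Continuous fun y => h.logHom y u :=
  (e (ContMDiffMap.rexp u)).contMDiff.continuous.log fun y => (h.rexp_pos u y).ne'

/-- If `z k → x` with defects `δ k = h.logHom (y k) (w k) - h.logHom (y k) 1 * w k (z k) > 0` at the
points `y k = φ.symm (z k)`, some `C^r` function `f` with `f x = 0` agrees near `z k` with the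
exponential of `n k * w k - round (n k * w k (z k)) - L k`, where `n k * δ k` exceeds the
contribution of the other terms; hence `e f ≥ 1` at `y k`, while `e f` vanishes at `φ.symm x`. -/
theorem not_frequently_logHom_ne (h : LiesOver e φ) (x : N) :
    ¬ ∃ᶠ z in 𝓝[≠] x, z ∈ {z | ∃ w, h.logHom (φ.symm z) w ≠ h.logHom (φ.symm z) 1 * w z} := by
  intro hfreq
  have := isCountablyGenerated_nhds_of_chartedSpace E x
  obtain ⟨z, U, hzS, hUo, hzU, hUx, hd, hU⟩ := exists_seq_pairwise_disjoint_nhds hfreq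
    ((chartAt E x).open_source.mem_nhds (mem_chart_source E x))
  have hw : ∀ k, ∃ w, 0 < h.logHom (φ.symm (z k)) w - h.logHom (φ.symm (z k)) 1 * w (z k) := by
    intro k
    obtain ⟨w, hw⟩ := hzS k
    -- replacing `w` by `-w` changes the sign of the defect
    rcases lt_or_gt_of_ne hw with hlt | hgt
    · refine ⟨-w, ?_⟩
      have : (-w) (z k) = -(w (z k)) := rfl
      rw [map_neg, this]
      linarith
    · exact ⟨w, sub_pos.2 hgt⟩
  choose w hw using hw
  have hz : Tendsto z atTop (𝓝 x) := fun W hW => (hU W hW).mono fun k hk => hk (hzU k)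
  obtain ⟨f, n, L, hfx, hf, hP⟩ := ContMDiffMap.exists_eventuallyEq_exp hUo hzU hUx hd hz w
    (fun k => |h.logHom (φ.symm (z k)) 1|) _ hw
  have h1 : ∀ᶠ k in atTop, 1 ≤ e f (φ.symm (z k)) := by
    filter_upwards [hf] with k hk
    set y := φ.symm (z k) with hy
    set R : ℤ := round (n k * w k (z k)) with hR
    let u : C^r⟮𝓘(ℝ, E), N; ℝ⟯ := n k • w k - R • (1 : C^r⟮𝓘(ℝ, E), N; ℝ⟯) -
      L k • (1 : C^r⟮𝓘(ℝ, E), N; ℝ⟯)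
    have hu : ∀ v, u v = n k * w k v - R - L k := by
      intro v
      have h2 : u = (n k : ℝ) • w k - (R : ℝ) • (1 : C^r⟮𝓘(ℝ, E), N; ℝ⟯) -
          (L k : ℝ) • (1 : C^r⟮𝓘(ℝ, E), N; ℝ⟯) := by
        simp only [u, Nat.cast_smul_eq_nsmul, Int.cast_smul_eq_zsmul]
      rw [h2]
      change (n k : ℝ) * w k v - (R : ℝ) * 1 - (L k : ℝ) * 1 = _
      ring
    have hfu : f =ᶠ[𝓝 (φ y)] ContMDiffMap.rexp u := by
      rw [hy, φ.apply_symm_apply]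
      filter_upwards [hk] with v hv
      rw [hv, ContMDiffMap.rexp_apply, hu]
    rw [((h _ _ _).1 hfu).self_of_nhds, ← h.exp_logHom]
    refine Real.one_le_exp ?_
    have hPk := hP k
    rw [← hy] at hPk
    simp only [u, map_sub, map_nsmul, map_zsmul]
    simp only [nsmul_eq_mul, zsmul_eq_mul]
    set p := h.logHom y 1
    have habs : |(n k * w k (z k) - R) * p - L k * p| ≤ |p| * (1 + L k) := by
      rw [← sub_mul, abs_mul, mul_comm]
      refine mul_le_mul_of_nonneg_left ((abs_sub _ _).trans ?_) (abs_nonneg p)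
      have h3 := abs_sub_round (n k * w k (z k))
      rw [← hR] at h3
      rw [Nat.abs_cast]
      linarith
    linarith [(abs_le.1 habs).1]
  have h2 : Tendsto (fun k => e f (φ.symm (z k))) atTop (𝓝 (e f (φ.symm x))) :=
    (((e f).contMDiff.continuous.comp φ.symm.continuous).tendsto x).comp hz
  have h3 : e f (φ.symm x) = 0 := by
    by_contra h0
    rw [← ne_eq, ← h.ne_zero_iff, φ.apply_symm_apply] at h0
    exact h0 hfx
  linarith [ge_of_tendsto h2 h1]

/-- The exceptional points have no accumulation point, so the identity, which is closed in `y`, holds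
everywhere. -/
theorem logHom_eq [Nontrivial E] (h : LiesOver e φ) (y : M) (u : C^r⟮𝓘(ℝ, E), N; ℝ⟯) :
    h.logHom y u = h.logHom y 1 * u (φ y) := by
  have := nhdsNE_neBot_of_chartedSpace E (φ y)
  have h1 := not_frequently.1 (h.not_frequently_logHom_ne (φ y))
  have hc : Continuous fun z => h.logHom (φ.symm z) u - h.logHom (φ.symm z) 1 * u z :=
    ((h.continuous_logHom u).comp φ.symm.continuous).sub
      (((h.continuous_logHom 1).comp φ.symm.continuous).mul u.contMDiff.continuous)
  have h2 : Tendsto (fun z => h.logHom (φ.symm z) u - h.logHom (φ.symm z) 1 * u z) (𝓝[≠] (φ y))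
      (𝓝 0) := by
    refine tendsto_const_nhds.congr' ?_
    filter_upwards [h1] with z hz
    by_contra hne
    exact hz ⟨u, fun h0 => hne (sub_eq_zero.2 h0).symm⟩
  have h3 := tendsto_nhds_unique ((hc.tendsto (φ y)).mono_left nhdsWithin_le_nhds) h2
  simpa [sub_eq_zero] using h3

/-- On positive functions `e` is a power with exponent depending only on the point. -/
theorem apply_eq_rpow [Nontrivial E] (h : LiesOver e φ) {y : M} {g : C^r⟮𝓘(ℝ, E), N; ℝ⟯}
    (hg : 0 < g (φ y)) : e g y = g (φ y) ^ h.logHom y 1 := by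
  have h1 : ContMDiffAt 𝓘(ℝ, E) 𝓘(ℝ) r (fun z => Real.log (g z)) (φ y) :=
    (Real.contDiffAt_log.2 hg.ne').contMDiffAt.comp _ g.contMDiff.contMDiffAt
  obtain ⟨u, hu⟩ := ContMDiffMap.exists_eventuallyEq h1
  have h2 : g =ᶠ[𝓝 (φ y)] ContMDiffMap.rexp u := by
    filter_upwards [hu, g.contMDiff.continuous.continuousAt.eventually_const_lt hg] with z hz hz0
    rw [ContMDiffMap.rexp_apply, hz, Real.exp_log hz0]
  rw [((h _ _ _).1 h2).self_of_nhds, ← h.exp_logHom, h.logHom_eq, hu.self_of_nhds,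
    Real.rpow_def_of_pos hg, mul_comm]

end LiesOver

end Positive

/-! ### The exponent is one -/

theorem Homeomorph.tendsto_nhdsNE {X Y : Type*} [TopologicalSpace X] [TopologicalSpace Y]
    (φ : X ≃ₜ Y) (x : X) : Tendsto φ (𝓝[≠] x) (𝓝[≠] (φ x)) :=
  φ.continuous.continuousAt.continuousWithinAt.tendsto_nhdsWithin
    fun _ hz => φ.injective.ne hz

section Exponent

variable {E : Type*} [NormedAddCommGroup E] [InnerProductSpace ℝ E] [FiniteDimensional ℝ E]
  {F : Type*} [NormedAddCommGroup F] [InnerProductSpace ℝ F] [FiniteDimensional ℝ F]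
  [Nontrivial F] {r : ℕ}
  {N : Type*} [TopologicalSpace N] [T2Space N] [ChartedSpace E N] [IsManifold 𝓘(ℝ, E) r N]
  {M : Type*} [TopologicalSpace M] [T2Space M] [ChartedSpace F M] [IsManifold 𝓘(ℝ, F) r M]
  {e : C^r⟮𝓘(ℝ, E), N; ℝ⟯ ≃* C^r⟮𝓘(ℝ, F), M; ℝ⟯} {φ : M ≃ₜ N}

namespace LiesOver

/-- The exponents of `e` and of its inverse at corresponding points are inverse to each other. -/
theorem logHom_one_mul_symm (h : LiesOver e φ) (y : M) :
    h.logHom y 1 * h.symm.logHom (φ y) 1 = 1 := by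
  have h1 : e (ContMDiffMap.rexp 1) (φ.symm (φ y)) = Real.exp (h.logHom y 1) := by
    rw [φ.symm_apply_apply, h.exp_logHom]
  have h2 := h.symm.apply_eq_rpow (y := φ y) (g := e (ContMDiffMap.rexp 1))
    (by rw [h1]; exact Real.exp_pos _)
  rw [e.symm_apply_apply, h1, ← Real.exp_mul] at h2
  exact (Real.exp_injective h2).symm

variable [Nontrivial E]

/-- A function with an isolated zero at `φ y` has values tending to `0` along `𝓝[≠] (φ y)`, and so
do the corresponding powers, which forces nonnegative exponents near `y`. -/
theorem logHom_one_pos (h : LiesOver e φ) (y : M) : 0 < h.logHom y 1 := by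
  have := nhdsNE_neBot_of_chartedSpace F y
  obtain ⟨f, hf0, hf⟩ := ContMDiffMap.exists_isolated_zero (E := E) (r := r) (φ y)
  have hef : e f y = 0 := by
    by_contra hne
    exact h.ne_zero_iff.2 hne hf0
  have h1 : ∀ᶠ z in 𝓝[≠] y, 0 ≤ h.logHom z 1 := by
    have hlt1 : ∀ᶠ z in 𝓝[≠] y, f (φ z) < 1 := nhdsWithin_le_nhds
      ((f.contMDiff.continuous.comp φ.continuous).continuousAt.eventually_lt_const
        (by simp [hf0]))
    have hlt2 : ∀ᶠ z in 𝓝[≠] y, e f z < 1 := nhdsWithin_le_nhds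
      ((e f).contMDiff.continuous.continuousAt.eventually_lt_const (by simp [hef]))
    filter_upwards [(φ.tendsto_nhdsNE y).eventually hf, hlt1, hlt2] with z hz hz1 hz2
    by_contra! hneg
    rw [h.apply_eq_rpow hz] at hz2
    exact hz2.not_ge (Real.one_le_rpow_of_pos_of_le_one_of_nonpos hz hz1.le hneg.le)
  have h2 : 0 ≤ h.logHom y 1 :=
    ge_of_tendsto (((h.continuous_logHom 1).tendsto y).mono_left nhdsWithin_le_nhds) h1
  exact h2.lt_of_ne fun h0 => by simpa [← h0] using h.logHom_one_mul_symm y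

theorem abs_apply_eq_rpow (h : LiesOver e φ) (y : M) (g : C^r⟮𝓘(ℝ, E), N; ℝ⟯) :
    |e g y| = |g (φ y)| ^ h.logHom y 1 := by
  by_cases hg : g (φ y) = 0
  · have : e g y = 0 := by
      by_contra hne
      exact h.ne_zero_iff.2 hne hg
    rw [hg, this, abs_zero, Real.zero_rpow (h.logHom_one_pos y).ne']
  · have h1 := h.apply_eq_rpow (y := y) (g := g * g) (mul_self_pos.2 hg)
    have h2 : (g * g) (φ y) = |g (φ y)| * |g (φ y)| := (abs_mul_abs_self _).symm
    rw [map_mul, h2, Real.mul_rpow (abs_nonneg _) (abs_nonneg _)] at h1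
    refine (mul_self_inj (abs_nonneg _) (Real.rpow_nonneg (abs_nonneg _) _)).1 ?_
    rw [← h1, abs_mul_abs_self]
    rfl

/-- If the exponent is less than `s < 1` near `t`, then `|f ∘ φ - f (φ t)|` is at most
`|e (f - f (φ t))| ^ (1 / s)`, where `e (f - f (φ t))` is differentiable and vanishes at `t`. -/
theorem hasFDerivAt_zero_of_logHom_one_lt (h : LiesOver e φ) (hr : 1 ≤ r) {s : ℝ} (hs : s < 1)
    (f : C^r⟮𝓘(ℝ, E), N; ℝ⟯) {c : OpenPartialHomeomorph M F}
    (hc : ContMDiffOn 𝓘(ℝ, F) 𝓘(ℝ, F) r c.symm c.target) {t : F} (ht : t ∈ c.target)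
    (hp : ∀ᶠ y in 𝓝 (c.symm t), h.logHom y 1 < s) :
    HasFDerivAt (fun t => f (φ (c.symm t))) (0 : F →L[ℝ] ℝ) t := by
  have hs0 : 0 < s := (h.logHom_one_pos _).trans hp.self_of_nhds
  have hs1 : 1 < 1 / s := by rwa [lt_div_iff₀ hs0, one_mul]
  let a : ℝ := f (φ (c.symm t))
  let g : C^r⟮𝓘(ℝ, E), N; ℝ⟯ := f - ContMDiffMap.const a
  have hg : ∀ z, g z = f z - a := fun z => rfl
  let G : F → ℝ := e g ∘ c.symm
  have hcd : ContDiffAt ℝ r G t := by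
    rw [← contMDiffAt_iff_contDiffAt]
    exact (e g).contMDiff.contMDiffAt.comp t (hc.contMDiffAt (c.open_target.mem_nhds ht))
  have hGt : G t = 0 := by
    have h1 := h.abs_apply_eq_rpow (c.symm t) g
    rw [hg, sub_self, abs_zero, Real.zero_rpow (h.logHom_one_pos _).ne', abs_eq_zero] at h1
    exact h1
  have hGO : G =O[𝓝 t] fun t' => t' - t := by
    have h1 := (hcd.differentiableAt (by exact_mod_cast (by lia : r ≠ 0))).isBigO_sub
    simpa [hGt] using h1
  have hG0 : Tendsto (fun t' => |G t'|) (𝓝 t) (𝓝 0) := by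
    simpa [hGt] using hcd.continuousAt.tendsto.abs
  have hle : ∀ᶠ t' in 𝓝 t, |f (φ (c.symm t')) - a| ≤ |G t'| ^ (1 / s) := by
    filter_upwards [hG0.eventually_le_const one_pos,
      (c.symm.continuousAt ht).eventually hp] with t' h1 h2
    have hp0 := h.logHom_one_pos (c.symm t')
    have h3 : |G t'| = |f (φ (c.symm t')) - a| ^ h.logHom (c.symm t') 1 :=
      h.abs_apply_eq_rpow (c.symm t') g
    have h4 : |f (φ (c.symm t')) - a| = |G t'| ^ (1 / h.logHom (c.symm t') 1) := by
      rw [h3, ← Real.rpow_mul (abs_nonneg _), mul_one_div_cancel hp0.ne', Real.rpow_one]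
    rw [h4]
    exact Real.rpow_le_rpow_of_exponent_ge' (abs_nonneg _) h1 (by positivity)
      (one_div_le_one_div_of_le hp0 h2.le)
  have hlittle : (fun t' => f (φ (c.symm t')) - a) =o[𝓝 t] G := by
    rw [Asymptotics.isLittleO_iff]
    intro b hb
    have h1 : Tendsto (fun t' => |G t'| ^ (1 / s - 1)) (𝓝 t) (𝓝 0) := by
      have := hG0.rpow_const (p := 1 / s - 1) (Or.inr (by linarith))
      rwa [Real.zero_rpow (by linarith)] at this
    filter_upwards [hle, h1.eventually_le_const hb] with t' h2 h3
    rw [Real.norm_eq_abs, Real.norm_eq_abs]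
    refine h2.trans ?_
    have h4 : |G t'| ^ (1 / s) = |G t'| ^ (1 / s - 1) * |G t'| := by
      nth_rewrite 3 [← Real.rpow_one |G t'|]
      rw [← Real.rpow_add_of_nonneg (abs_nonneg _) (by linarith) one_pos.le, sub_add_cancel]
    rw [h4]
    gcongr
  rw [hasFDerivAt_iff_isLittleO]
  simpa using hlittle.trans_isBigO hGO

/-- Otherwise every `C^r` function on `N` would be constant near `φ y`, since its pull-back along `φ`
has zero derivative in a chart at `y`. -/
theorem one_le_logHom_one (h : LiesOver e φ) (hr : 1 ≤ r) (y : M) : 1 ≤ h.logHom y 1 := by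
  by_contra! hlt
  obtain ⟨s, hps, hs⟩ := exists_between hlt
  obtain ⟨f, hf0, hf⟩ := ContMDiffMap.exists_isolated_zero (E := E) (r := r) (φ y)
  set c := chartAt F y
  have hp : ∀ᶠ z in 𝓝 y, ∀ᶠ z' in 𝓝 z, h.logHom z' 1 < s :=
    ((h.continuous_logHom 1).continuousAt.eventually_lt_const hps).eventually_nhds
  have hyc : y ∈ c.source := mem_chart_source F y
  have htc : c y ∈ c.target := c.map_source hyc
  have hnear : ∀ᶠ t in 𝓝 (c y), t ∈ c.target ∧ ∀ᶠ z' in 𝓝 (c.symm t), h.logHom z' 1 < s := by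
    rw [← c.left_inv hyc] at hp
    exact Eventually.and (c.open_target.mem_nhds htc)
      ((c.symm.continuousAt htc).tendsto.eventually hp)
  obtain ⟨ρ, hρ, hball⟩ := Metric.eventually_nhds_iff_ball.1 hnear
  have hder : ∀ t ∈ Metric.ball (c y) ρ,
      HasFDerivAt (fun t => f (φ (c.symm t))) (0 : F →L[ℝ] ℝ) t := fun t ht =>
    h.hasFDerivAt_zero_of_logHom_one_lt hr hs f (contMDiffOn_chart_symm (I := 𝓘(ℝ, F)))
      (hball t ht).1 (hball t ht).2
  have hconst : ∀ᶠ z in 𝓝 y, f (φ z) = 0 := by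
    filter_upwards [(c.continuousAt hyc).eventually (Metric.ball_mem_nhds (c y) hρ),
      c.open_source.mem_nhds hyc] with z hz hzc
    have h1 := Metric.isOpen_ball.is_const_of_fderiv_eq_zero (𝕜 := ℝ)
      (convex_ball (c y) ρ).isPreconnected
      (fun t ht => (hder t ht).differentiableAt.differentiableWithinAt)
      (fun t ht => (hder t ht).fderiv) hz (Metric.mem_ball_self hρ)
    simpa [c.left_inv hzc, c.left_inv hyc, hf0] using h1
  have := nhdsNE_neBot_of_chartedSpace F y
  obtain ⟨z, hz1, hz2⟩ := (((φ.tendsto_nhdsNE y).eventually hf).and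
    (hconst.filter_mono nhdsWithin_le_nhds)).exists
  exact hz1.ne' hz2

theorem logHom_one_eq_one (h : LiesOver e φ) (hr : 1 ≤ r) (y : M) : h.logHom y 1 = 1 := by
  have h1 := h.one_le_logHom_one hr y
  have h2 := h.symm.one_le_logHom_one hr (φ y)
  have h3 := h.logHom_one_mul_symm y
  nlinarith

theorem apply_eq (h : LiesOver e φ) (hr : 1 ≤ r) (g : C^r⟮𝓘(ℝ, E), N; ℝ⟯) (y : M) :
    e g y = g (φ y) := by
  have hpos : ∀ k : C^r⟮𝓘(ℝ, E), N; ℝ⟯, 0 < k (φ y) → e k y = k (φ y) := fun k hk => by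
    rw [h.apply_eq_rpow hk, h.logHom_one_eq_one hr, Real.rpow_one]
  rcases lt_trichotomy (g (φ y)) 0 with hg | hg | hg
  · have h1 : e g y = e (-1) y * e (-g) y := by
      rw [← Pi.mul_apply, ← ContMDiffMap.coe_mul, ← map_mul, neg_one_mul, neg_neg]
    have h2 : (-g) (φ y) = -g (φ y) := rfl
    rw [h1, h.apply_neg_one, hpos (-g) (by rw [h2]; linarith), h2]
    ring
  · rw [hg]
    by_contra hne
    exact h.ne_zero_iff.2 hne hg
  · exact hpos g hg

end LiesOver

end Exponent

/-! ### Regularity of the homeomorphism -/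

section Regularity

variable {E : Type*} [NormedAddCommGroup E] [InnerProductSpace ℝ E] [FiniteDimensional ℝ E]
  {F : Type*} [NormedAddCommGroup F] [InnerProductSpace ℝ F] {r : ℕ}
  {N : Type*} [TopologicalSpace N] [T2Space N] [ChartedSpace E N] [IsManifold 𝓘(ℝ, E) r N]
  {M : Type*} [TopologicalSpace M] [ChartedSpace F M]

/-- A continuous map is of class `C^r` if it pulls `C^r` functions back to `C^r` functions: the
coordinates of a chart extend, as germs, to global functions. -/
theorem contMDiff_of_forall_comp_contMDiff {φ : M → N} (hφ : Continuous φ)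
    (h : ∀ g : C^r⟮𝓘(ℝ, E), N; ℝ⟯, ContMDiff 𝓘(ℝ, F) 𝓘(ℝ) r (g ∘ φ)) :
    ContMDiff 𝓘(ℝ, F) 𝓘(ℝ, E) r φ := by
  intro y
  rw [contMDiffAt_iff_target]
  refine ⟨hφ.continuousAt, ?_⟩
  let b := Module.finBasis ℝ E
  have hcoord : ∀ i, ContMDiffAt 𝓘(ℝ, F) 𝓘(ℝ) r
      (fun z => b.equivFunL (extChartAt 𝓘(ℝ, E) (φ y) (φ z)) i) y := by
    intro i
    have h1 : ContMDiffAt 𝓘(ℝ, E) 𝓘(ℝ) r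
        (fun z => b.equivFunL (extChartAt 𝓘(ℝ, E) (φ y) z) i) (φ y) := by
      have h2 : ContDiff ℝ r fun v : E => b.equivFunL v i :=
        (contDiff_apply ℝ ℝ i).comp b.equivFunL.contDiff
      exact h2.contMDiff.contMDiffAt.comp (φ y) contMDiffAt_extChartAt
    obtain ⟨g, hg⟩ := ContMDiffMap.exists_eventuallyEq h1
    exact (h g y).congr_of_eventuallyEq (hφ.continuousAt.eventually hg.symm)
  have h3 : ContMDiffAt 𝓘(ℝ, F) 𝓘(ℝ, Fin (Module.finrank ℝ E) → ℝ) r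
      (fun z => b.equivFunL (extChartAt 𝓘(ℝ, E) (φ y) (φ z))) y :=
    contMDiffAt_pi_space.2 hcoord
  have h4 := b.equivFunL.symm.contDiff.contMDiff.contMDiffAt.comp (n := r) y h3
  simpa [Function.comp_def] using h4

theorem ContMDiffMap.eq_of_forall_apply_eq {x x' : N}
    (h : ∀ g : C^r⟮𝓘(ℝ, E), N; ℝ⟯, g x = g x') : x = x' := by
  by_contra hne
  obtain ⟨b, hb1, hb⟩ := ContMDiffMap.exists_bump (E := E) (r := r) x
    (isOpen_compl_singleton.mem_nhds hne)
  have h1 : b x = 1 := hb1.self_of_nhds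
  exact hb (subset_tsupport _ (((h b).symm.trans h1).trans_ne one_ne_zero)) rfl

end Regularity

theorem theorem1 (r : ℕ) (hr : 1 ≤ r) (m n : ℕ) (hm : 0 < m) (hn : 0 < n)
    (M : Type*) [TopologicalSpace M] [T2Space M]
    [ChartedSpace (EuclideanSpace ℝ (Fin m)) M] [IsManifold (𝓡 m) (r : ℕ∞ω) M]
    (N : Type*) [TopologicalSpace N] [T2Space N]
    [ChartedSpace (EuclideanSpace ℝ (Fin n)) N] [IsManifold (𝓡 n) (r : ℕ∞ω) N]
    (B : ContMDiffMap (𝓡 n) 𝓘(ℝ, ℝ) N ℝ (r : ℕ∞ω) → ContMDiffMap (𝓡 m) 𝓘(ℝ, ℝ) M ℝ (r : ℕ∞ω))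
    (hB_mul : ∀ g h, B (g * h) = B g * B h)
    (hB_bij : Function.Bijective B) :
    (∃! φ : Diffeomorph (𝓡 m) (𝓡 n) M N (r : ℕ∞ω), ∀ g, ∀ x : M, B g x = g (φ x)) ∧
    (∃ A : ContMDiffMap (𝓡 n) 𝓘(ℝ, ℝ) N ℝ (r : ℕ∞ω) ≃ₐ[ℝ]
        ContMDiffMap (𝓡 m) 𝓘(ℝ, ℝ) M ℝ (r : ℕ∞ω), ∀ g, A g = B g) := by
  have : NeZero m := ⟨hm.ne'⟩
  have : NeZero n := ⟨hn.ne'⟩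
  let e : C^r⟮𝓡 n, N; ℝ⟯ ≃* C^r⟮𝓡 m, M; ℝ⟯ :=
    { Equiv.ofBijective B hB_bij with map_mul' := hB_mul }
  obtain ⟨φ, hφ⟩ := e.exists_liesOver
  have hB : ∀ g x, B g x = g (φ x) := hφ.apply_eq hr
  have hC : ∀ g x, e.symm g x = g (φ.symm x) := hφ.symm.apply_eq hr
  refine ⟨⟨⟨φ.toEquiv, ?_, ?_⟩, hB, ?_⟩, ?_⟩
  · refine contMDiff_of_forall_comp_contMDiff φ.continuous fun g => ?_
    exact (B g).contMDiff.congr fun x => (hB g x).symm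
  · refine contMDiff_of_forall_comp_contMDiff φ.symm.continuous fun g => ?_
    exact (e.symm g).contMDiff.congr fun x => (hC g x).symm
  · intro ψ hψ
    ext x
    exact ContMDiffMap.eq_of_forall_apply_eq fun g => (hψ g x).symm.trans (hB g x)
  · refine ⟨AlgEquiv.ofRingEquiv (f := { e with map_add' := fun g k => ?_ }) fun a => ?_,
      fun g => rfl⟩
    · ext x
      exact (hB _ _).trans (congrArg₂ (· + ·) (hB g x).symm (hB k x).symm)
    · ext x
      exact hB _ _
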